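/- Let $\mathbb K$ be a field of characteristic $0$, let $n\ge 1$, and let $V=\bigoplus_{\alpha\in\mathbb Z^n}V^\alpha$ be a $\mathbb Z^n$-graded $\mathbb K$-vector space. For $a,b\in\mathbb Z^n$ put $\langle a,b\rangle=\sum_i a_ib_i$; inside such brackets a homogeneous vector stands for its degree. Let $T(V)=\bigoplus_{p\ge1}V^{\otimes p}$ be the reduced tensor space with the induced $\mathbb Z^n$-grading, $T(V)^\alpha=\bigoplus_{p\ge 1}\bigoplus_{\beta_1+\dots+\beta_p=\alpha}V^{\beta_1}\otimes\dots\otimes V^{\beta_p}$. For homogeneous $v_1,\dots,v_p\in V$ and a subset $I=\{i_1<\dots<i_k\}$ of $\{1,\dots,p\}$ write $V_I=v_{i_1}\otimes\dots\otimes v_{i_k}$ and $\langle Q,V_I\rangle=\sum_{i\in I}\langle Q,v_i\rangle$, and for disjoint subsets $I,J$ let $\varepsilon_V(I;J)=\prod_{i\in I,\,j\in J,\,j<i}(-1)^{\langle v_i,v_j\rangle}$ be the Koszul sign of the rearrangement of $(V_I;V_J)$ into the natural order. Let $\Delta:T(V)\to T(V)\bigotimes T(V)$ be the linear map with $$\Delta(v_1\otimes\dots\otimes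 v_p)=\sum_{\substack{I\sqcup J=\{1,\dots,p-1\}\\ I\ne\emptyset}}\varepsilon_V(I;J)\;V_I\bigotimes (V_J\otimes v_p)$$ for homogeneous $v_1,\dots,v_p$, $p\ge1$. For $Q\in\mathbb Z^n$ let $\mathrm{CoDer}^Q(T(V))$ be the vector space of linear maps $D:T(V)\to T(V)$ with $D(T(V)^\alpha)\subset T(V)^{\alpha+Q}$ for all $\alpha$ and $\Delta D=(D\otimes\mathrm{id}+\mathrm{id}\otimes D)\Delta$, where $(D\otimes\mathrm{id})(x\otimes y)=D(x)\otimes y$ and $(\mathrm{id}\otimes D)(x\otimes y)=(-1)^{\langle Q,\alpha\rangle}x\otimes D(y)$ for $x\in T(V)^\alpha$. For $p\ge1$ let $M^{(Q,p-1)}(V)$ be the space of $p$-linear maps $f:V^{\times p}\to V$ of weight $Q$, i.e. $f(V^{\beta_1}\times\dots\times V^{\beta_p})\subset V^{Q+\beta_1+\dots+\beta_p}$ (equivalently, linear maps $V^{\otimes p}\to V$ of weight $Q$). Then, for every $Q\in\mathbb Z^n$, the map $$\psi_Q:\mathrm{CoDer}^Q(T(V))\to\prod_{p\ge1}M^{(Q,p-1)}(V),\qquad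 D\mapsto(D_1,D_2,\dots),$$ where $D_p:V^{\otimes p}\hookrightarrow T(V)\xrightarrow{D}T(V)\xrightarrow{\mathrm{pr}}V$ are the corestriction maps of $D$ ($\mathrm{pr}$ being the canonical projection), is an isomorphism of vector spaces. Its inverse sends a sequence $(Q_1,Q_2,\dots)$ to the coderivation $D$ given, for homogeneous $v_1,\dots,v_p\in V$, $p\ge 1$, by $$D(v_1\otimes\dots\otimes v_p)=\sum_{k=1}^{p}\;\sum_{I\sqcup J=\{1,\dots,k-1\}}\varepsilon_V(I;J)\,(-1)^{\langle Q,V_I\rangle}\;V_I\otimes Q_{|J|+1}(V_J\otimes v_k)\otimes v_{k+1}\otimes\dots\otimes v_p,$$ where $I$ and $J$ may be empty. -/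

import Mathlib

open scoped TensorProduct DirectSum

namespace DualLeibniz

noncomputable section

/-- The pairing `⟨a, b⟩ = ∑ i, a i * b i` on `ℤⁿ`. -/
def pairing {n : ℕ} (a b : Fin n → ℤ) : ℤ := ∑ i, a i * b i

/-- The sign `(-1) ^ ⟨a, b⟩`. -/
def pairSign {n : ℕ} (a b : Fin n → ℤ) : ℤ := (pairing a b).negOnePow

/-- The Koszul sign `ε_V(I; J)` of `V_(I;J) → V_(I ∪ J)`, where `I`, `J` are disjoint, each of them
is listed in increasing order, and `v i` has degree `d i`: restoring the natural order moves `v i`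
(`i ∈ I`) past `v j` (`j ∈ J`) exactly when `j < i`, at the price of a sign `(-1) ^ ⟨d i, d j⟩`. -/
def koszulSign {n p : ℕ} (d : Fin p → Fin n → ℤ) (I J : Finset (Fin p)) : ℤ :=
  ∏ i ∈ I, ∏ j ∈ J with j < i, pairSign (d i) (d j)

/-- `V_I = (v_{i₁}, …, v_{i_k})` for `I = {i₁ < ⋯ < i_k}`. -/
def subtuple {X : Type*} {p : ℕ} (v : Fin p → X) (I : Finset (Fin p)) : Fin I.card → X :=
  fun k => v (I.orderEmbOfFin rfl k)

/-- The reduced tensor space `T(V) = ⨁_{p ≥ 1} V^{⊗ p}`; the summand of index `p` is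
`V^{⊗ (p + 1)}`. -/
abbrev RedTensor (K V : Type*) [Field K] [AddCommGroup V] [Module K V] : Type _ :=
  ⨁ p : ℕ, ⨂[K] _ : Fin (p + 1), V

section General

variable {K V : Type*} [Field K] [AddCommGroup V] [Module K V]

/-- The word `v₁ ⊗ ⋯ ⊗ v_m` in `T(V)`, for `m ≥ 1`. There is no empty word in `T(V)`; for `m = 0`
the value is set to `0`, and this case never enters below. -/
def word : (m : ℕ) → MultilinearMap K (fun _ : Fin m => V) (RedTensor K V)
  | 0 => 0
  | m + 1 => (DirectSum.lof K ℕ (fun p => ⨂[K] _ : Fin (p + 1), V) m).compMultilinearMap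
      (PiTensorProduct.tprod K)

/-- The canonical projection `pr : T(V) → V`. -/
def proj : RedTensor K V →ₗ[K] V :=
  (PiTensorProduct.subsingletonEquiv (R := K) (s := fun _ : Fin 1 => V) (0 : Fin 1)).toLinearMap ∘ₗ
    DirectSum.component K ℕ (fun p => ⨂[K] _ : Fin (p + 1), V) 0

theorem proj_word_one (v : Fin 1 → V) : proj (K := K) (word 1 v) = v 0 := by
  simp [proj, word, DirectSum.component.lof_self]

theorem proj_word_add_two (m : ℕ) (v : Fin (m + 2) → V) :
    proj (K := K) (word (m + 2) v) = 0 := by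
  simp [proj, word, DirectSum.component.of]

/-- A linear map out of `T(V)` given by its values on words. -/
def liftWord {M : Type*} [AddCommMonoid M] [Module K M]
    (f : (p : ℕ) → MultilinearMap K (fun _ : Fin (p + 1) => V) M) : RedTensor K V →ₗ[K] M :=
  DirectSum.toModule K ℕ M fun p => PiTensorProduct.lift (f p)

theorem liftWord_word {M : Type*} [AddCommMonoid M] [Module K M]
    (f : (p : ℕ) → MultilinearMap K (fun _ : Fin (p + 1) => V) M) (p : ℕ) (v : Fin (p + 1) → V) :
    liftWord f (word (p + 1) v) = f p v := by
  simp [liftWord, word]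

/-- The multilinear map `v ↦ V_I ⨂ V_{Iᶜ}` with values in `T(V) ⊗ T(V)`
(meaningful for `I` and its complement both non-empty). -/
def splitWord {p : ℕ} (I : Finset (Fin p)) :
    MultilinearMap K (fun _ : Fin p => V) (RedTensor K V ⊗[K] RedTensor K V) :=
  MultilinearMap.domDomCongr (finSumEquivOfFinset (s := I) rfl rfl)
    (MultilinearMap.domCoprod (word I.card) (word Iᶜ.card))

theorem splitWord_apply {p : ℕ} (I : Finset (Fin p)) (v : Fin p → V) :
    splitWord (K := K) I v = word _ (subtuple v I) ⊗ₜ[K] word _ (subtuple v Iᶜ) := rfl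

end General

section Graded

variable {K V : Type*} [Field K] [AddCommGroup V] [Module K V] {n : ℕ}
  (𝒱 : (Fin n → ℤ) → Submodule K V)

/-- `M^{(Q, a)}(V)`, `a ≥ 0`: the `(a + 1)`-linear maps `V × ⋯ × V → V` of weight `Q`. -/
def weightMultilinear (Q : Fin n → ℤ) (a : ℕ) :
    Submodule K (MultilinearMap K (fun _ : Fin (a + 1) => V) V) where
  carrier := {f | ∀ (d : Fin (a + 1) → Fin n → ℤ) (v : Fin (a + 1) → V),
    (∀ i, v i ∈ 𝒱 (d i)) → f v ∈ 𝒱 (Q + ∑ i, d i)}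
  add_mem' hf hg d v hv := (𝒱 _).add_mem (hf d v hv) (hg d v hv)
  zero_mem' _ _ _ := (𝒱 _).zero_mem
  smul_mem' c _ hf d v hv := (𝒱 _).smul_mem c (hf d v hv)

/-- `T(V)^α`: spanned by the words in homogeneous vectors with total degree `α`. -/
def tensorGrading (α : Fin n → ℤ) : Submodule K (RedTensor K V) :=
  Submodule.span K {x | ∃ (p : ℕ) (d : Fin (p + 1) → Fin n → ℤ) (v : Fin (p + 1) → V),
    (∀ i, v i ∈ 𝒱 (d i)) ∧ ∑ i, d i = α ∧ x = word (p + 1) v}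

theorem proj_mem (α : Fin n → ℤ) (x : RedTensor K V) (hx : x ∈ tensorGrading 𝒱 α) :
    proj x ∈ 𝒱 α := by
  induction hx using Submodule.span_induction with
  | mem x hx =>
    obtain ⟨p, d, v, hv, rfl, rfl⟩ := hx
    cases p with
    | zero => rw [proj_word_one]; simpa using hv 0
    | succ p => rw [proj_word_add_two]; exact Submodule.zero_mem _
  | zero => simp
  | add x y _ _ hx hy => rw [map_add]; exact Submodule.add_mem _ hx hy
  | smul c x _ hx => rw [map_smul]; exact Submodule.smul_mem _ c hx

variable [DirectSum.Decomposition 𝒱]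

/-- Multiply a multilinear map by a sign that depends on the degrees of its arguments: the unique
multilinear map with value `ε d • f v` whenever `v i` is homogeneous of degree `d i`
(see `twist_apply`). -/
def twist {p : ℕ} {M : Type*} [AddCommMonoid M] [Module K M] (ε : (Fin p → Fin n → ℤ) → ℤ)
    (f : MultilinearMap K (fun _ : Fin p => V) M) : MultilinearMap K (fun _ : Fin p => V) M :=
  (MultilinearMap.fromDirectSumEquiv (R := K) (κ := fun _ : Fin p => Fin n → ℤ)
      (M := fun _ α => 𝒱 α) (M' := M)
      fun d => (ε d : K) • f.compLinearMap fun i => (𝒱 (d i)).subtype).compLinearMap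
    fun _ => (DirectSum.decomposeLinearEquiv 𝒱).toLinearMap

theorem twist_apply {p : ℕ} {M : Type*} [AddCommMonoid M] [Module K M]
    (ε : (Fin p → Fin n → ℤ) → ℤ) (f : MultilinearMap K (fun _ : Fin p => V) M)
    (d : Fin p → Fin n → ℤ) (v : Fin p → V) (hv : ∀ i, v i ∈ 𝒱 (d i)) :
    twist 𝒱 ε f v = (ε d : K) • f v := by
  have h : (fun i => DirectSum.decomposeLinearEquiv 𝒱 (v i)) =
      fun i => DirectSum.lof K _ (fun α => 𝒱 α) (d i) ⟨v i, hv i⟩ := by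
    funext i
    exact DirectSum.decompose_of_mem 𝒱 (hv i)
  simp only [twist, MultilinearMap.compLinearMap_apply, LinearEquiv.coe_coe]
  rw [h, MultilinearMap.fromDirectSumEquiv_lof]
  rfl

/-- The coproduct of `T(V)`: for `v i` homogeneous of degree `d i`, `i = 1, …, p + 1`,
`Δ (v₁ ⊗ ⋯ ⊗ v_{p+1}) = ∑ ε_V(I; J) V_I ⨂ (V_J ⊗ v_{p+1})`, summed over `I ⊔ J = {1, …, p}`,
`I ≠ ∅`. Since `p + 1` is the largest index, `V_J ⊗ v_{p+1}` is the word of the complement of `I`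
in `{1, …, p + 1}`. -/
def coproduct : RedTensor K V →ₗ[K] RedTensor K V ⊗[K] RedTensor K V :=
  liftWord fun p =>
    ∑ I : Finset (Fin (p + 1)) with I.Nonempty ∧ Fin.last p ∉ I,
      twist 𝒱 (fun d => koszulSign d I (Iᶜ.erase (Fin.last p))) (splitWord I)

theorem coproduct_word {p : ℕ} (d : Fin (p + 1) → Fin n → ℤ) (v : Fin (p + 1) → V)
    (hv : ∀ i, v i ∈ 𝒱 (d i)) :
    coproduct 𝒱 (word (p + 1) v) =
      ∑ I : Finset (Fin (p + 1)) with I.Nonempty ∧ Fin.last p ∉ I,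
        (koszulSign d I (Iᶜ.erase (Fin.last p)) : K) •
          (word _ (subtuple v I) ⊗ₜ[K] word _ (subtuple v Iᶜ)) := by
  rw [coproduct, liftWord_word, sum_apply]
  refine Finset.sum_congr rfl fun I _ => ?_
  rw [twist_apply 𝒱 _ _ d v hv, splitWord_apply]

/-- The sign operator `x ↦ (-1) ^ ⟨Q, α⟩ x` for `x ∈ T(V)^α`. -/
def degSign (Q : Fin n → ℤ) : RedTensor K V →ₗ[K] RedTensor K V :=
  liftWord fun p => twist 𝒱 (fun d => pairSign Q (∑ i, d i)) (word (p + 1))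

theorem degSign_apply (Q α : Fin n → ℤ) (x : RedTensor K V) (hx : x ∈ tensorGrading 𝒱 α) :
    degSign 𝒱 Q x = (pairSign Q α : K) • x := by
  induction hx using Submodule.span_induction with
  | mem x hx =>
    obtain ⟨p, d, v, hv, rfl, rfl⟩ := hx
    rw [degSign, liftWord_word, twist_apply 𝒱 _ _ d v hv]
  | zero => simp
  | add x y _ _ hx hy => rw [map_add, hx, hy, smul_add]
  | smul c x _ hx => rw [map_smul, hx, smul_comm]

/-- The tensor product of linear maps, where `g` has weight `Q`:
`(f ⊗ g) (x ⊗ y) = (-1) ^ ⟨Q, deg x⟩ f x ⊗ g y`. -/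
def gradedMap (f g : RedTensor K V →ₗ[K] RedTensor K V) (Q : Fin n → ℤ) :
    RedTensor K V ⊗[K] RedTensor K V →ₗ[K] RedTensor K V ⊗[K] RedTensor K V :=
  TensorProduct.map (f ∘ₗ degSign 𝒱 Q) g

/-- `CoDer^Q(T(V))`: the linear maps `D : T(V) → T(V)` of weight `Q` that satisfy the co-Leibniz
identity `Δ D = (D ⊗ id + id ⊗ D) Δ`. -/
def CoDer (Q : Fin n → ℤ) : Submodule K (RedTensor K V →ₗ[K] RedTensor K V) where
  carrier := {D | (∀ α, ∀ x ∈ tensorGrading 𝒱 α, D x ∈ tensorGrading 𝒱 (Q + α)) ∧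
    coproduct 𝒱 ∘ₗ D =
      (gradedMap 𝒱 D LinearMap.id 0 + gradedMap 𝒱 LinearMap.id D Q) ∘ₗ coproduct 𝒱}
  add_mem' := by
    rintro D E ⟨hD, hD'⟩ ⟨hE, hE'⟩
    refine ⟨fun α x hx => Submodule.add_mem _ (hD α x hx) (hE α x hx), ?_⟩
    rw [LinearMap.comp_add, hD', hE', ← LinearMap.add_comp]
    simp only [gradedMap, LinearMap.add_comp, TensorProduct.map_add_left,
      TensorProduct.map_add_right]
    abel
  zero_mem' := by
    refine ⟨fun α x _ => Submodule.zero_mem _, ?_⟩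
    simp [gradedMap]
  smul_mem' := by
    rintro c D ⟨hD, hD'⟩
    refine ⟨fun α x hx => Submodule.smul_mem _ c (hD α x hx), ?_⟩
    rw [LinearMap.comp_smul, hD']
    simp only [gradedMap, LinearMap.smul_comp, TensorProduct.map_smul_left,
      TensorProduct.map_smul_right, LinearMap.add_comp, smul_add]

/-- The map `ψ_Q` from `CoDer^Q(T(V))` to `∏_{a ≥ 0} M^{(Q, a)}(V)` that sends `D` to its
corestriction maps `V^{⊗ (a + 1)} ↪ T(V) → T(V) → V`, viewed as multilinear maps. -/
def corestrictions (Q : Fin n → ℤ) :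
    CoDer 𝒱 Q →ₗ[K] ((a : ℕ) → weightMultilinear 𝒱 Q a) where
  toFun D a := ⟨(proj ∘ₗ (D : RedTensor K V →ₗ[K] RedTensor K V)).compMultilinearMap (word (a + 1)),
    fun d v hv => proj_mem 𝒱 _ _
      (D.2.1 _ _ (Submodule.subset_span ⟨a, d, v, hv, rfl, rfl⟩))⟩
  map_add' D E := by
    funext a
    ext v
    simp
  map_smul' c D := by
    funext a
    ext v
    simp

end Graded

end

end DualLeibniz

open DualLeibniz

/-!
All identities are checked on words in homogeneous letters, which span `T(V)`. Such a word is
encoded as the list of its letters from the last to the first, because the last letter plays a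
special role both in `Δ` and in the formula for `D`. The sum of `ε_V(I; J) f(V_I, V_J)` over all
decompositions `I ⊔ J` then becomes a recursion on lists (`unshuffleSum`): a new last letter joins
either `V_I`, where it passes all of `V_J`, or `V_J`, where it produces no sign. In these terms
`Δ(l v) = ∑ ε a ⊗ b v` over the unshuffles `(a, b)` of `l` (`coprodSum`; the empty word `a` may be
included, because it is mapped to `0` in `T(V)`), and the formula for `D` reads
`D(l v) = D(l) v + ∑ ε (-1)^⟨Q, a⟩ a ⊗ q(b v)` (`coderSum`).

The co-Leibniz rule is proved for `Δ` and for the unshuffle coproduct `Sh` simultaneously, by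
induction on the length. Comparing `Δ D(l v)` with `(D ⊗ id + id ⊗ D) Δ(l v)`, the terms with
`D(l) v` agree by the rule for `Sh` on `l`, and the terms in which `v` is absorbed by `q` agree by
the coassociativity of `Sh` (`coderSum_coprodSum_cons`). Since `Sh` is the sum of `Δ` and its
signed transpose on non-empty words, the rule for `Δ` on `l v` gives the rule for `Sh` on `l v`
(`coderSum_unshuffleSum`).

For uniqueness, let `ι : V → T(V)` be the inclusion and `μ(u ⊗ w) = u ⊗ pr(w)`. Then
`x = ι(pr x) + μ(Δ x)` for all `x` (`incl_proj_add_appendProj_coproduct`), so a coderivation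
satisfies `D = ι pr D + μ (D ⊗ id + id ⊗ D) Δ`, which determines it from `pr D` by induction on the
length of words (`corestrictions_injective`). The same equation, iterated from `0`, yields a
linear map with given corestrictions (`coderOf`); by `coderSum_letterWord_cons` its values on words
are given by `coderSum`, and `sum_eq_coderSum` turns these into sums over subsets.
-/

namespace DualLeibniz

/-! ### Signs -/

section Signs

variable {n : ℕ}

theorem pairing_add_left (a b c : Fin n → ℤ) : pairing (a + b) c = pairing a c + pairing b c := by
  simp [pairing, add_mul, Finset.sum_add_distrib]

theorem pairing_comm (a b : Fin n → ℤ) : pairing a b = pairing b a := by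
  simp [pairing, mul_comm]

theorem pairSign_comm (a b : Fin n → ℤ) : pairSign a b = pairSign b a := by
  rw [pairSign, pairSign, pairing_comm]

theorem pairSign_add_left (a b c : Fin n → ℤ) :
    pairSign (a + b) c = pairSign a c * pairSign b c := by
  simp [pairSign, pairing_add_left, Int.negOnePow_add]

theorem pairSign_add_right (a b c : Fin n → ℤ) :
    pairSign a (b + c) = pairSign a b * pairSign a c := by
  rw [pairSign_comm, pairSign_add_left, pairSign_comm b, pairSign_comm c]

@[simp] theorem pairSign_zero_left (a : Fin n → ℤ) : pairSign 0 a = 1 := by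
  simp [pairSign, pairing]

@[simp] theorem pairSign_zero_right (a : Fin n → ℤ) : pairSign a 0 = 1 := by
  simp [pairSign, pairing]

theorem pairSign_mul_self (a b : Fin n → ℤ) : pairSign a b * pairSign a b = 1 := by
  rw [pairSign, ← Units.val_mul, Int.units_mul_self, Units.val_one]

theorem pairSign_sum_right {ι : Type*} (a : Fin n → ℤ) (s : Finset ι) (d : ι → Fin n → ℤ) :
    pairSign a (∑ i ∈ s, d i) = ∏ i ∈ s, pairSign a (d i) := by
  classical
  induction s using Finset.induction_on with
  | empty => simp
  | insert i s hi ih => rw [Finset.sum_insert hi, Finset.prod_insert hi, pairSign_add_right, ih]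

end Signs

/-! ### Unshuffles of words, as recursions on lists -/

section Lists

variable {n : ℕ} {H : Type*} (δ : H → Fin n → ℤ) {M N : Type*} [AddCommGroup M] [AddCommGroup N]

/-- The total degree of a word. -/
def wordDeg (l : List H) : Fin n → ℤ := (l.map δ).sum

@[simp] theorem wordDeg_nil : wordDeg δ [] = 0 := rfl

@[simp] theorem wordDeg_cons (v : H) (l : List H) : wordDeg δ (v :: l) = δ v + wordDeg δ l := by
  simp [wordDeg]

theorem wordDeg_append (l l' : List H) : wordDeg δ (l ++ l') = wordDeg δ l + wordDeg δ l' := by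
  simp [wordDeg]

theorem wordDeg_perm {l l' : List H} (h : l.Perm l') : wordDeg δ l = wordDeg δ l' :=
  (h.map δ).sum_eq

theorem wordDeg_of_append_perm {a b l : List H} (h : (a ++ b).Perm l) :
    wordDeg δ l = wordDeg δ a + wordDeg δ b := by
  rw [← wordDeg_perm δ h, wordDeg_append]

/-- `∑ ε_V(I; J) f(V_I, V_J)` over all decompositions `I ⊔ J` of the set of positions of a word.
The list carries the letters of the word from the last to the first, so that its head, when put
into `V_I`, passes all of `V_J`. -/
def unshuffleSum : List H → (List H → List H → M) → M
  | [], f => f [] []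
  | v :: l, f => unshuffleSum l fun a b =>
      pairSign (δ v) (wordDeg δ b) • f (v :: a) b + f a (v :: b)

/-- `∑ ε_V(I; J) f(V_I, V_J ⊗ v)` for the word `V_{I ⊔ J} ⊗ v`, where `I` and `J` may be empty;
words are listed from the last letter to the first. -/
def coprodSum : List H → (List H → List H → M) → M
  | [], _ => 0
  | v :: l, f => unshuffleSum δ l fun a b => f a (v :: b)

/-- The candidate `D` for the coderivation, applied to a word and followed by a map `f` defined on
words: the letter `q v b` stands for `Q_{|b| + 1}(b ⊗ v)`. Words are listed from the last letter to
the first; the second summand collects the terms in which `v`, the last letter, is absorbed. -/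
def coderSum (Q : Fin n → ℤ) (q : H → List H → H) : List H → (List H → M) → M
  | [], _ => 0
  | v :: l, f => coderSum Q q l (fun x => f (v :: x)) +
      unshuffleSum δ l fun a b => pairSign Q (wordDeg δ a) • f (q v b :: a)

theorem map_unshuffleSum {F : Type*} [FunLike F M N] [AddMonoidHomClass F M N] (φ : F)
    (l : List H) (f : List H → List H → M) :
    φ (unshuffleSum δ l f) = unshuffleSum δ l fun a b => φ (f a b) := by
  induction l generalizing f with
  | nil => rfl
  | cons v l ih => simp only [unshuffleSum, ih, map_add, map_zsmul]

theorem unshuffleSum_add (l : List H) (f g : List H → List H → M) :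
    (unshuffleSum δ l fun a b => f a b + g a b) = unshuffleSum δ l f + unshuffleSum δ l g := by
  induction l generalizing f g with
  | nil => rfl
  | cons v l ih =>
    simp only [unshuffleSum]
    rw [← ih]
    congr 1
    funext a b
    rw [smul_add]
    abel

theorem unshuffleSum_smul (c : ℤ) (l : List H) (f : List H → List H → M) :
    (unshuffleSum δ l fun a b => c • f a b) = c • unshuffleSum δ l f :=
  (map_unshuffleSum δ (zsmulAddGroupHom c) l f).symm

theorem unshuffleSum_congr {l : List H} {f g : List H → List H → M}
    (h : ∀ a b, (a ++ b).Perm l → f a b = g a b) : unshuffleSum δ l f = unshuffleSum δ l g := by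
  induction l generalizing f g with
  | nil => exact h [] [] (List.Perm.refl _)
  | cons v l ih =>
    refine ih fun a b hab => ?_
    rw [h (v :: a) b (hab.cons v), h a (v :: b) (List.perm_middle.trans (hab.cons v))]

/-- Only `J = ∅` contributes if `f` vanishes as soon as its second argument is non-empty. -/
theorem unshuffleSum_eq_right {l : List H} {f : List H → List H → M}
    (h : ∀ a b, b ≠ [] → f a b = 0) : unshuffleSum δ l f = f l [] := by
  induction l generalizing f with
  | nil => rfl
  | cons v l ih =>
    rw [unshuffleSum, ih]
    · simp [h]
    · intro a b hb
      simp [h, hb]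

/-- Only `I = ∅` contributes if `f` vanishes as soon as its first argument is non-empty. -/
theorem unshuffleSum_eq_left {l : List H} {f : List H → List H → M}
    (h : ∀ a b, a ≠ [] → f a b = 0) : unshuffleSum δ l f = f [] l := by
  induction l generalizing f with
  | nil => rfl
  | cons v l ih =>
    rw [unshuffleSum, ih]
    · simp [h]
    · intro a b ha
      simp [h, ha]

/-- Coassociativity of the unshuffle coproduct. -/
theorem unshuffleSum_coassoc (l : List H) (f : List H → List H → List H → M) :
    (unshuffleSum δ l fun a b => unshuffleSum δ a fun a₁ a₂ => f a₁ a₂ b) =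
      unshuffleSum δ l fun a b => unshuffleSum δ b fun b₁ b₂ => f a b₁ b₂ := by
  induction l generalizing f with
  | nil => rfl
  | cons v l ih =>
    simp only [unshuffleSum, ← unshuffleSum_smul, ← unshuffleSum_add]
    rw [ih fun a b c => pairSign (δ v) (wordDeg δ c) •
      (pairSign (δ v) (wordDeg δ b) • f (v :: a) b c + f a (v :: b) c) + f a b (v :: c)]
    refine unshuffleSum_congr δ fun a b _ => unshuffleSum_congr δ fun b₁ b₂ hb => ?_
    rw [wordDeg_of_append_perm δ hb, pairSign_add_right, smul_add, smul_smul, add_assoc,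
      mul_comm]

/-- Cocommutativity, up to the Koszul sign, of the unshuffle coproduct. -/
theorem unshuffleSum_cocomm (l : List H) (f : List H → List H → M) :
    (unshuffleSum δ l fun a b => pairSign (wordDeg δ a) (wordDeg δ b) • f b a) =
      unshuffleSum δ l f := by
  induction l generalizing f with
  | nil => simp [unshuffleSum]
  | cons v l ih =>
    simp only [unshuffleSum]
    rw [← ih]
    refine unshuffleSum_congr δ fun a b _ => ?_
    simp only [wordDeg_cons, pairSign_add_left, pairSign_add_right, smul_add, smul_smul]
    rw [pairSign_comm (wordDeg δ b) (δ v), pairSign_comm (wordDeg δ b) (wordDeg δ a), add_comm]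
    have hab := pairSign_mul_self (wordDeg δ a) (wordDeg δ b)
    have hva := pairSign_mul_self (δ v) (wordDeg δ a)
    refine congrArg₂ (· + ·) (congrArg (· • f (v :: a) b) ?_)
      ((congrArg (· • f a (v :: b)) ?_).trans (one_smul ℤ _))
    · linear_combination pairSign (δ v) (wordDeg δ b) * hab
    · linear_combination pairSign (δ v) (wordDeg δ a) * pairSign (δ v) (wordDeg δ a) * hab + hva

theorem map_coprodSum {F : Type*} [FunLike F M N] [AddMonoidHomClass F M N] (φ : F)
    (l : List H) (f : List H → List H → M) :
    φ (coprodSum δ l f) = coprodSum δ l fun a b => φ (f a b) := by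
  cases l with
  | nil => exact map_zero φ
  | cons v l => exact map_unshuffleSum δ φ l _

theorem coprodSum_add (l : List H) (f g : List H → List H → M) :
    (coprodSum δ l fun a b => f a b + g a b) = coprodSum δ l f + coprodSum δ l g := by
  cases l with
  | nil => simp [coprodSum]
  | cons v l => exact unshuffleSum_add δ l _ _

theorem coprodSum_congr {l : List H} {f g : List H → List H → M}
    (h : ∀ a b, (a ++ b).Perm l → b ≠ [] → f a b = g a b) : coprodSum δ l f = coprodSum δ l g := by
  cases l with
  | nil => rfl
  | cons v l =>
    exact unshuffleSum_congr δ fun a b hab =>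
      h a (v :: b) (List.perm_middle.trans (hab.cons v)) (List.cons_ne_nil _ _)

/-- On non-empty words the unshuffle coproduct is the sum of the dual Leibniz coproduct (including
the term with `I = ∅`) and its transpose. -/
theorem unshuffleSum_eq_coprodSum_add {l : List H} (hl : l ≠ []) (f : List H → List H → M) :
    unshuffleSum δ l f = coprodSum δ l f +
      coprodSum δ l fun a b => pairSign (wordDeg δ a) (wordDeg δ b) • f b a := by
  obtain ⟨v, l, rfl⟩ := List.exists_cons_of_ne_nil hl
  simp only [unshuffleSum, coprodSum, unshuffleSum_add]
  rw [add_comm, ← unshuffleSum_cocomm δ l fun a b => pairSign (δ v) (wordDeg δ b) • f (v :: a) b]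
  congr 2
  funext a b
  rw [wordDeg_cons, pairSign_add_right, smul_smul, mul_comm, pairSign_comm (δ v)]

variable {Q : Fin n → ℤ} {q : H → List H → H}

theorem map_coderSum {F : Type*} [FunLike F M N] [AddMonoidHomClass F M N] (φ : F)
    (l : List H) (f : List H → M) :
    φ (coderSum δ Q q l f) = coderSum δ Q q l fun x => φ (f x) := by
  induction l generalizing f with
  | nil => exact map_zero φ
  | cons v l ih => simp only [coderSum, ih, map_add, map_unshuffleSum, map_zsmul]

theorem coderSum_add (l : List H) (f g : List H → M) :
    (coderSum δ Q q l fun x => f x + g x) = coderSum δ Q q l f + coderSum δ Q q l g := by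
  induction l generalizing f g with
  | nil => simp [coderSum]
  | cons v l ih =>
    simp only [coderSum, ih, smul_add, unshuffleSum_add]
    abel

theorem coderSum_zero (l : List H) : (coderSum δ Q q l fun _ => (0 : M)) = 0 := by
  simpa using (map_coderSum δ (Q := Q) (q := q) (0 : M →+ M) l fun _ => 0).symm

theorem coderSum_smul (c : ℤ) (l : List H) (f : List H → M) :
    (coderSum δ Q q l fun x => c • f x) = c • coderSum δ Q q l f :=
  (map_coderSum δ (zsmulAddGroupHom c) l f).symm

theorem coderSum_congr (hq : ∀ v b, δ (q v b) = Q + wordDeg δ (v :: b))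
    {l : List H} {f g : List H → M}
    (h : ∀ x, x ≠ [] → wordDeg δ x = Q + wordDeg δ l → f x = g x) :
    coderSum δ Q q l f = coderSum δ Q q l g := by
  induction l generalizing f g with
  | nil => rfl
  | cons v l ih =>
    refine congrArg₂ (· + ·) (ih fun x _ hx => h _ (List.cons_ne_nil _ _) ?_)
      (unshuffleSum_congr δ fun a b hab => ?_)
    · rw [wordDeg_cons, wordDeg_cons, hx, add_left_comm]
    · rw [h _ (List.cons_ne_nil _ _)]
      rw [wordDeg_cons, wordDeg_cons, hq, wordDeg_cons, wordDeg_of_append_perm δ hab]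
      abel

/-- If the co-Leibniz rule with respect to the unshuffle coproduct holds on a word, then the rule
with respect to the dual Leibniz coproduct holds on the word with one more letter. -/
theorem coderSum_coprodSum_cons (v : H) (l : List H)
    (hl : ∀ f : List H → List H → M, (coderSum δ Q q l fun x => unshuffleSum δ x f) =
      unshuffleSum δ l fun a b => (coderSum δ Q q a fun x => f x b) +
        pairSign Q (wordDeg δ a) • coderSum δ Q q b fun x => f a x)
    (f : List H → List H → M) :
    (coderSum δ Q q (v :: l) fun x => coprodSum δ x f) =
      coprodSum δ (v :: l) fun a b => (coderSum δ Q q a fun x => f x b) +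
        pairSign Q (wordDeg δ a) • coderSum δ Q q b fun x => f a x := by
  simp only [coderSum, coprodSum]
  rw [hl]
  simp only [smul_add, ← add_assoc, unshuffleSum_add]
  congr 1
  simp only [← unshuffleSum_smul, smul_smul]
  rw [← unshuffleSum_coassoc δ l fun a₁ a₂ b =>
    (pairSign Q (wordDeg δ a₁) * pairSign Q (wordDeg δ a₂)) • f a₁ (q v b :: a₂)]
  refine unshuffleSum_congr δ fun a b _ => unshuffleSum_congr δ fun a₁ a₂ ha => ?_
  rw [wordDeg_of_append_perm δ ha, pairSign_add_right]

/-- The co-Leibniz rule with respect to the unshuffle coproduct. The rule for the dual Leibniz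
coproduct, obtained from the shorter word, is added to its transpose. -/
theorem coderSum_unshuffleSum (hq : ∀ v b, δ (q v b) = Q + wordDeg δ (v :: b))
    (l : List H) (f : List H → List H → M) :
    (coderSum δ Q q l fun x => unshuffleSum δ x f) =
      unshuffleSum δ l fun a b => (coderSum δ Q q a fun x => f x b) +
        pairSign Q (wordDeg δ a) • coderSum δ Q q b fun x => f a x := by
  induction l generalizing f with
  | nil => simp [coderSum, unshuffleSum]
  | cons v l ih =>
    rw [coderSum_congr δ hq fun x hx _ => unshuffleSum_eq_coprodSum_add δ hx f, coderSum_add,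
      coderSum_coprodSum_cons δ v l ih, coderSum_coprodSum_cons δ v l ih,
      unshuffleSum_eq_coprodSum_add δ (List.cons_ne_nil v l)]
    congr 2
    funext a b
    rw [coderSum_congr δ hq (l := a) (g := fun x =>
        (pairSign Q (wordDeg δ b) * pairSign (wordDeg δ a) (wordDeg δ b)) • f b x)
        fun x _ hx => by rw [hx, pairSign_add_left],
      coderSum_congr δ hq (l := b) (g := fun x =>
        (pairSign Q (wordDeg δ a) * pairSign (wordDeg δ a) (wordDeg δ b)) • f x a)
        fun x _ hx => by rw [hx, pairSign_add_right, pairSign_comm _ Q],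
      coderSum_smul, coderSum_smul, smul_smul, ← mul_assoc, pairSign_mul_self, one_mul, smul_add,
      smul_smul, add_comm, mul_comm (pairSign Q _)]

/-- The co-Leibniz rule with respect to the dual Leibniz coproduct. -/
theorem coderSum_coprodSum (hq : ∀ v b, δ (q v b) = Q + wordDeg δ (v :: b))
    (l : List H) (f : List H → List H → M) :
    (coderSum δ Q q l fun x => coprodSum δ x f) =
      coprodSum δ l fun a b => (coderSum δ Q q a fun x => f x b) +
        pairSign Q (wordDeg δ a) • coderSum δ Q q b fun x => f a x := by
  cases l with
  | nil => rfl
  | cons v l => exact coderSum_coprodSum_cons δ v l (fun f => coderSum_unshuffleSum δ hq l f) f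

end Lists

/-! ### Sums over subsets of positions -/

section Finsets

variable {n p : ℕ} {H : Type*} {M : Type*} [AddCommGroup M]

/-- The reversed word of `V_X`: the letters `h i`, `i ∈ X`, from the last to the first. -/
def revWord (h : Fin p → H) (X : Finset (Fin p)) : List H := (X.sort (· ≥ ·)).map h

@[simp] theorem revWord_empty (h : Fin p → H) : revWord h ∅ = [] := by simp [revWord]

theorem revWord_insert (h : Fin p → H) {a : Fin p} {X : Finset (Fin p)} (ha : ∀ x ∈ X, x < a) :
    revWord h (insert a X) = h a :: revWord h X := by
  rw [revWord, Finset.sort_insert _ (fun b hb => (ha b hb).le) fun h' => (ha a h').false]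
  rfl

theorem wordDeg_revWord (δ : H → Fin n → ℤ) (h : Fin p → H) (X : Finset (Fin p)) :
    wordDeg δ (revWord h X) = ∑ i ∈ X, δ (h i) := by
  induction X using Finset.induction_on_max with
  | empty => simp
  | insert a X ha ih =>
    rw [revWord_insert h ha, wordDeg_cons, ih, Finset.sum_insert fun h' => (ha a h').false]

theorem koszulSign_insert_left (d : Fin p → Fin n → ℤ) {a : Fin p} {I J : Finset (Fin p)}
    (haI : a ∉ I) (haJ : ∀ x ∈ J, x < a) :
    koszulSign d (insert a I) J = pairSign (d a) (∑ j ∈ J, d j) * koszulSign d I J := by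
  rw [koszulSign, Finset.prod_insert haI, Finset.filter_true_of_mem haJ, pairSign_sum_right]
  rfl

theorem koszulSign_insert_right (d : Fin p → Fin n → ℤ) {a : Fin p} {I J : Finset (Fin p)}
    (haI : ∀ x ∈ I, x < a) : koszulSign d I (insert a J) = koszulSign d I J := by
  refine Finset.prod_congr rfl fun i hi => ?_
  rw [Finset.filter_insert, if_neg (haI i hi).not_gt]

/-- The recursion `unshuffleSum` computes the sum over all subsets `I` of a set `X` of positions.
The largest position of `X` is split off. -/
theorem sum_powerset_eq_unshuffleSum (δ : H → Fin n → ℤ) (h : Fin p → H) (X : Finset (Fin p))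
    (f : List H → List H → M) :
    ∑ I ∈ X.powerset, koszulSign (fun i => δ (h i)) I (X \ I) •
      f (revWord h I) (revWord h (X \ I)) = unshuffleSum δ (revWord h X) f := by
  induction X using Finset.induction_on_max generalizing f with
  | empty => simp [unshuffleSum, koszulSign]
  | insert a X ha ih =>
    have haX : a ∉ X := fun h' => (ha a h').false
    rw [revWord_insert h ha, unshuffleSum, ← ih, Finset.sum_powerset_insert haX, add_comm,
      ← Finset.sum_add_distrib]
    refine Finset.sum_congr rfl fun I hI => ?_
    have hIX := Finset.mem_powerset.1 hI
    have haI : a ∉ I := fun h' => haX (hIX h')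
    have hJ : ∀ x ∈ X \ I, x < a := fun x hx => ha x (Finset.sdiff_subset hx)
    rw [Finset.insert_sdiff_insert, Finset.sdiff_insert_of_notMem haX,
      Finset.insert_sdiff_of_notMem _ haI,
      koszulSign_insert_left _ haI hJ, koszulSign_insert_right _ fun x hx => ha x (hIX hx),
      revWord_insert h hJ, revWord_insert h fun x hx => ha x (hIX hx), wordDeg_revWord, smul_add,
      smul_smul, mul_comm]

/-- The recursion `coderSum` computes the double sum over the position `k` of the last letter
that is absorbed and the subsets `I` of the positions before `k`. -/
theorem sum_eq_coderSum (δ : H → Fin n → ℤ) (Q : Fin n → ℤ) (q : H → List H → H)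
    (h : Fin p → H) (X : Finset (Fin p)) (f : List H → M) :
    ∑ k ∈ X, ∑ I ∈ (X.filter (· < k)).powerset,
      (koszulSign (fun i => δ (h i)) I (X.filter (· < k) \ I) *
        pairSign Q (∑ i ∈ I, δ (h i))) •
        f (revWord h (X.filter (k < ·)) ++
          q (h k) (revWord h (X.filter (· < k) \ I)) :: revWord h I) =
      coderSum δ Q q (revWord h X) f := by
  induction X using Finset.induction_on_max generalizing f with
  | empty => simp [coderSum]
  | insert a X ha ih =>
    have haX : a ∉ X := fun h' => (ha a h').false
    rw [revWord_insert h ha, coderSum, ← ih, Finset.sum_insert haX, add_comm]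
    congr 1
    · refine Finset.sum_congr rfl fun k hk => ?_
      rw [Finset.filter_insert, if_neg (ha k hk).not_gt, Finset.filter_insert,
        if_pos (ha k hk), revWord_insert h fun x hx => ha x (Finset.filter_subset _ _ hx)]
      rfl
    · rw [Finset.filter_insert, if_neg (lt_irrefl a), Finset.filter_true_of_mem ha,
        Finset.filter_insert, if_neg (lt_irrefl a),
        Finset.filter_false_of_mem fun x hx => (ha x hx).not_gt, revWord_empty,
        ← sum_powerset_eq_unshuffleSum]
      simp only [wordDeg_revWord, smul_smul, List.nil_append]

theorem ofFn_subtuple (h : Fin p → H) (X : Finset (Fin p)) :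
    List.ofFn (subtuple h X) = X.sort.map h := by
  rw [← X.listMap_orderEmbOfFin_finRange rfl, List.map_map, List.ofFn_eq_map]
  rfl

theorem ofFn_subtuple_univ (h : Fin p → H) :
    List.ofFn (subtuple h Finset.univ) = List.ofFn h := by
  rw [ofFn_subtuple, Fin.sort_univ, List.ofFn_eq_map]

/-- Reversing a reversed word gives the tuple `V_X` in its natural order. -/
theorem reverse_revWord (h : Fin p → H) (X : Finset (Fin p)) :
    (revWord h X).reverse = List.ofFn (subtuple h X) := by
  have hX : (X.sort (· ≥ ·)).reverse = X.sort := by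
    refine List.Perm.eq_of_pairwise' ?_ (X.pairwise_sort _) ?_
    · exact List.pairwise_reverse.2 (X.pairwise_sort _)
    · rw [← Multiset.coe_eq_coe]
      simp
  rw [revWord, ← List.map_reverse, hX, ofFn_subtuple]

/-- Every list is the reversed word of a tuple, so that statements on lists and on tuples can be
translated into each other. -/
theorem exists_eq_revWord_univ (l : List H) :
    ∃ (p : ℕ) (h : Fin p → H), l = revWord h Finset.univ := by
  refine ⟨_, l.reverse.get, List.reverse_injective ?_⟩
  rw [reverse_revWord, ofFn_subtuple_univ, List.ofFn_get]

end Finsets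

noncomputable section

/-! ### Appending letters in the reduced tensor space -/

section Concat

variable {K V : Type*} [Field K] [AddCommGroup V] [Module K V]

/-- The word of `T(V)` with a given list of letters; `0` for the empty list. -/
def wordOfList (l : List V) : RedTensor K V := word l.length l.get

@[simp] theorem wordOfList_nil : wordOfList (K := K) ([] : List V) = 0 := rfl

theorem wordOfList_ofFn {m : ℕ} (v : Fin m → V) :
    wordOfList (K := K) (List.ofFn v) = word m v :=
  congrArg (fun s : Σ m, Fin m → V => word s.1 s.2) (List.equivSigmaTuple.right_inv ⟨m, v⟩)

theorem ofFn_snoc {X : Type*} {m : ℕ} (v : Fin m → X) (x : X) :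
    List.ofFn (Fin.snoc (α := fun _ => X) v x) = List.ofFn v ++ [x] := by
  rw [List.ofFn_succ']
  simp

/-- Appending a letter at the end of a word. -/
def appendLetter : RedTensor K V →ₗ[K] V →ₗ[K] RedTensor K V :=
  liftWord fun p => (word (K := K) (V := V) (p + 2)).curryRight

theorem appendLetter_wordOfList {l : List V} (hl : l ≠ []) (x : V) :
    appendLetter (K := K) (wordOfList l) x = wordOfList (l ++ [x]) := by
  induction l using List.ofFnRec with
  | h m v =>
    cases m with
    | zero => simp at hl
    | succ m =>
      rw [← ofFn_snoc, wordOfList_ofFn, wordOfList_ofFn, appendLetter, liftWord_word,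
        MultilinearMap.curryRight_apply]

theorem proj_wordOfList_singleton (x : V) : proj (K := K) (wordOfList [x]) = x :=
  proj_word_one _

theorem proj_wordOfList_append {l : List V} (hl : l ≠ []) (x : V) :
    proj (K := K) (wordOfList (l ++ [x])) = 0 := by
  induction l using List.ofFnRec with
  | h m v =>
    cases m with
    | zero => simp at hl
    | succ m => rw [← ofFn_snoc, wordOfList_ofFn, proj_word_add_two]

/-- The linear map `u ⊗ w ↦ u ⊗ pr(w)` from `T(V) ⊗ T(V)` to `T(V)`. -/
def appendProj : RedTensor K V ⊗[K] RedTensor K V →ₗ[K] RedTensor K V :=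
  TensorProduct.lift (appendLetter.compl₂ proj)

@[simp] theorem appendProj_tmul (x y : RedTensor K V) :
    appendProj (x ⊗ₜ[K] y) = appendLetter x (proj y) := rfl

/-- The inclusion of `V` in `T(V)`. -/
def incl : V →ₗ[K] RedTensor K V :=
  DirectSum.lof K ℕ (fun p => ⨂[K] _ : Fin (p + 1), V) 0 ∘ₗ
    (PiTensorProduct.subsingletonEquiv (R := K) (s := fun _ : Fin 1 => V) (0 : Fin 1)).symm

theorem incl_apply (x : V) : incl (K := K) x = wordOfList [x] := by
  simp only [incl, LinearMap.comp_apply, LinearEquiv.coe_coe]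
  rw [show wordOfList (K := K) [x] = DirectSum.lof K ℕ (fun p => ⨂[K] _ : Fin (p + 1), V) 0
    (PiTensorProduct.tprod K fun _ : Fin 1 => x) from ?_]
  · congr 1
    rw [LinearEquiv.symm_apply_eq]
    simp
  · rw [← List.ofFn_get [x], wordOfList_ofFn]
    change _ = word 1 (fun _ => x)
    congr 1
    funext i
    simp

end Concat

/-! ### Words in homogeneous letters -/

section Homogeneous

variable {K V : Type*} [Field K] [AddCommGroup V] [Module K V] {n : ℕ}
  (𝒱 : (Fin n → ℤ) → Submodule K V)

/-- A homogeneous letter: a vector of `V` together with a degree. -/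
abbrev Letter : Type _ := Σ α : Fin n → ℤ, 𝒱 α

/-- The degree of a homogeneous letter. -/
abbrev letterDeg (x : Letter 𝒱) : Fin n → ℤ := x.1

variable {𝒱} in
/-- The vector underlying a homogeneous letter. -/
def Letter.val (x : Letter 𝒱) : V := x.2

/-- The word of `T(V)` whose letters, from the last to the first, are those of a list. -/
def letterWord (l : List (Letter 𝒱)) : RedTensor K V := wordOfList (l.map Letter.val).reverse

@[simp] theorem letterWord_nil : letterWord 𝒱 [] = 0 := rfl

theorem map_val_reverse_revWord {p : ℕ} (h : Fin p → Letter 𝒱) (X : Finset (Fin p)) :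
    ((revWord h X).map Letter.val).reverse = List.ofFn (subtuple (fun i => (h i).val) X) := by
  rw [← List.map_reverse, reverse_revWord, List.map_ofFn]
  rfl

theorem letterWord_revWord {p : ℕ} (h : Fin p → Letter 𝒱) (X : Finset (Fin p)) :
    letterWord 𝒱 (revWord h X) = word _ (subtuple (fun i => (h i).val) X) := by
  rw [letterWord, map_val_reverse_revWord, wordOfList_ofFn]

theorem letterWord_revWord_univ {p : ℕ} (h : Fin p → Letter 𝒱) :
    letterWord 𝒱 (revWord h Finset.univ) = word _ fun i => (h i).val := by
  rw [letterWord, map_val_reverse_revWord, ofFn_subtuple_univ, wordOfList_ofFn]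

theorem letterWord_cons_revWord {p : ℕ} (h : Fin p → Letter 𝒱) (I : Finset (Fin p))
    (x : Letter 𝒱) :
    letterWord 𝒱 (x :: revWord h I) =
      word _ (Fin.snoc (α := fun _ => V) (subtuple (fun i => (h i).val) I) x.val) := by
  rw [← wordOfList_ofFn, ofFn_snoc, letterWord, List.map_cons, List.reverse_cons,
    map_val_reverse_revWord]

theorem letterWord_append_cons_revWord {p : ℕ} (h : Fin p → Letter 𝒱) (I J : Finset (Fin p))
    (x : Letter 𝒱) :
    letterWord 𝒱 (revWord h J ++ x :: revWord h I) =
      word _ (Fin.append (Fin.snoc (α := fun _ => V) (subtuple (fun i => (h i).val) I) x.val)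
        (subtuple (fun i => (h i).val) J)) := by
  rw [← wordOfList_ofFn, List.ofFn_fin_append, ofFn_snoc, letterWord, List.map_append,
    List.map_cons, List.reverse_append, List.reverse_cons, map_val_reverse_revWord,
    map_val_reverse_revWord]

theorem appendLetter_letterWord {l : List (Letter 𝒱)} (hl : l ≠ []) (x : Letter 𝒱) :
    appendLetter (letterWord 𝒱 l) x.val = letterWord 𝒱 (x :: l) := by
  rw [letterWord, appendLetter_wordOfList (by simpa using hl)]
  simp [letterWord]

theorem proj_letterWord_singleton (x : Letter 𝒱) : proj (letterWord 𝒱 [x]) = x.val :=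
  proj_wordOfList_singleton _

theorem proj_letterWord_cons {l : List (Letter 𝒱)} (hl : l ≠ []) (x : Letter 𝒱) :
    proj (letterWord 𝒱 (x :: l)) = 0 := by
  rw [letterWord, List.map_cons, List.reverse_cons, proj_wordOfList_append (by simpa using hl)]

theorem letterWord_mem (l : List (Letter 𝒱)) :
    letterWord 𝒱 l ∈ tensorGrading 𝒱 (wordDeg (letterDeg 𝒱) l) := by
  obtain ⟨p, h, rfl⟩ := exists_eq_revWord_univ l
  cases p with
  | zero => simp
  | succ p =>
    exact Submodule.subset_span ⟨p, fun i => (h i).1, fun i => (h i).val, fun i => (h i).2.2,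
      (wordDeg_revWord _ h _).symm, letterWord_revWord_univ 𝒱 h⟩

variable [DirectSum.Decomposition 𝒱]

/-- Multilinear maps are determined by their values on homogeneous vectors. -/
theorem multilinearMap_ext_homogeneous {p : ℕ} {M : Type*} [AddCommMonoid M] [Module K M]
    {f g : MultilinearMap K (fun _ : Fin p => V) M}
    (h : ∀ x : Fin p → Letter 𝒱, f (fun i => (x i).val) = g (fun i => (x i).val)) : f = g := by
  have key : f.compLinearMap (fun _ => (DirectSum.decomposeLinearEquiv 𝒱).symm.toLinearMap) =
      g.compLinearMap (fun _ => (DirectSum.decomposeLinearEquiv 𝒱).symm.toLinearMap) := by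
    refine MultilinearMap.directSum_ext fun d => ?_
    ext x
    simp only [MultilinearMap.compLinearMap_apply, LinearEquiv.coe_coe]
    have e : ∀ i, (DirectSum.decomposeLinearEquiv 𝒱).symm
        (DirectSum.lof K _ (fun α => 𝒱 α) (d i) (x i)) = (x i : V) := fun i =>
      DirectSum.decompose_symm_of 𝒱 (x i)
    simp only [e]
    exact h fun i => ⟨d i, x i⟩
  ext v
  simpa using congrArg (fun F => F fun i => DirectSum.decomposeLinearEquiv 𝒱 (v i)) key

/-- Words in homogeneous letters span `T(V)`. -/
theorem linearMap_ext_letterWord {M : Type*} [AddCommMonoid M] [Module K M]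
    {φ χ : RedTensor K V →ₗ[K] M} (h : ∀ l, φ (letterWord 𝒱 l) = χ (letterWord 𝒱 l)) : φ = χ := by
  refine DirectSum.linearMap_ext K fun p => PiTensorProduct.ext ?_
  refine multilinearMap_ext_homogeneous 𝒱 fun x => ?_
  have := h (List.ofFn x).reverse
  rw [letterWord, ← List.map_reverse, List.reverse_reverse, List.map_ofFn, wordOfList_ofFn] at this
  exact this

/-- The coproduct of a word as a recursion; the term with `I = ∅` of `coprodSum` does not occur in
`Δ`, but it contributes `0` here. -/
theorem coproduct_letterWord (l : List (Letter 𝒱)) :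
    coproduct 𝒱 (letterWord 𝒱 l) =
      coprodSum (letterDeg 𝒱) l fun a b => letterWord 𝒱 a ⊗ₜ[K] letterWord 𝒱 b := by
  obtain ⟨p, h, rfl⟩ := exists_eq_revWord_univ l
  cases p with
  | zero => simp [coprodSum, Finset.univ_eq_empty]
  | succ p =>
    have hlt : ∀ x ∈ Finset.Iio (Fin.last p), x < Fin.last p := fun x hx => Finset.mem_Iio.1 hx
    have hrev : revWord h Finset.univ = h (Fin.last p) :: revWord h (Finset.Iio (Fin.last p)) := by
      rw [← revWord_insert h hlt]
      congr 1
      ext x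
      simp only [Finset.mem_univ, Finset.mem_insert, Finset.mem_Iio, true_iff]
      exact x.le_last.eq_or_lt
    rw [letterWord_revWord_univ,
      coproduct_word 𝒱 (fun i => (h i).1) (fun i => (h i).val) fun i => (h i).2.2, hrev,
      coprodSum, ← sum_powerset_eq_unshuffleSum]
    refine Finset.sum_subset_zero_on_sdiff ?_ ?_ ?_
    · intro I hI
      refine Finset.mem_powerset.2 fun x hx => Finset.mem_Iio.2 (lt_of_le_of_ne x.le_last ?_)
      rintro rfl
      exact (Finset.mem_filter.1 hI).2.2 hx
    · -- The term with `I = ∅` vanishes, since the empty word is `0` in `T(V)`.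
      intro I hI
      obtain ⟨hI, hI'⟩ := Finset.mem_sdiff.1 hI
      have hlast : Fin.last p ∉ I := fun h' => (hlt _ (Finset.mem_powerset.1 hI h')).false
      have : I = ∅ := by
        by_contra hne
        exact hI' (Finset.mem_filter.2
          ⟨Finset.mem_univ _, Finset.nonempty_iff_ne_empty.2 hne, hlast⟩)
      simp [this]
    · intro I hI
      have hlast := (Finset.mem_filter.1 hI).2.2
      have hJ : Iᶜ.erase (Fin.last p) = Finset.Iio (Fin.last p) \ I := by
        ext x
        simp only [Finset.mem_erase, Finset.mem_compl, Finset.mem_sdiff, Finset.mem_Iio,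
          Fin.lt_last_iff_ne_last]
      have hJ' : Iᶜ = insert (Fin.last p) (Finset.Iio (Fin.last p) \ I) := by
        rw [← hJ, Finset.insert_erase (Finset.mem_compl.2 hlast)]
      rw [hJ, ← letterWord_revWord, ← letterWord_revWord,
        hJ', revWord_insert h fun x hx => hlt x (Finset.sdiff_subset hx)]
      exact Int.cast_smul_eq_zsmul K (M := RedTensor K V ⊗[K] RedTensor K V) _ _

end Homogeneous

/-! ### Coderivations -/

section Coder

/-- The general lemma does not rewrite in `T(V)`, because its additive structure as a group and the
one underlying its module structure agree only up to unfolding. -/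
theorem intCast_smul_redTensor {K V : Type*} [Field K] [AddCommGroup V] [Module K V] (c : ℤ)
    (x : RedTensor K V) : (c : K) • x = c • x :=
  Int.cast_smul_eq_zsmul K (M := RedTensor K V) c x

variable {K V : Type*} [Field K] [AddCommGroup V] [Module K V] {n : ℕ}
  (𝒱 : (Fin n → ℤ) → Submodule K V)

/-- The linear map `T(V) → V` given by a sequence of multilinear maps of weight `Q`. -/
def ofWeightMultilinear {Q : Fin n → ℤ} (q : (a : ℕ) → weightMultilinear 𝒱 Q a) :
    RedTensor K V →ₗ[K] V :=
  liftWord fun a => (q a : MultilinearMap K (fun _ => V) V)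

theorem ofWeightMultilinear_mem {Q : Fin n → ℤ} (q : (a : ℕ) → weightMultilinear 𝒱 Q a)
    (α : Fin n → ℤ) (x : RedTensor K V) (hx : x ∈ tensorGrading 𝒱 α) :
    ofWeightMultilinear 𝒱 q x ∈ 𝒱 (Q + α) := by
  induction hx using Submodule.span_induction with
  | mem x hx =>
    obtain ⟨p, d, v, hv, rfl, rfl⟩ := hx
    rw [ofWeightMultilinear, liftWord_word]
    exact (q p).2 d v hv
  | zero => simp
  | add x y _ _ hx hy => rw [map_add]; exact Submodule.add_mem _ hx hy
  | smul c x _ hx => rw [map_smul]; exact Submodule.smul_mem _ c hx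

variable {𝒱} in
/-- The homogeneous letter `Q_{|b| + 1}(b ⊗ v)`; here `b` lists its letters from the last to the
first. -/
def absorb {Q : Fin n → ℤ} (q : (a : ℕ) → weightMultilinear 𝒱 Q a) (v : Letter 𝒱)
    (b : List (Letter 𝒱)) : Letter 𝒱 :=
  ⟨Q + wordDeg (letterDeg 𝒱) (v :: b), ofWeightMultilinear 𝒱 q (letterWord 𝒱 (v :: b)),
    ofWeightMultilinear_mem 𝒱 q _ _ (letterWord_mem 𝒱 _)⟩

variable {Q : Fin n → ℤ} (q : (a : ℕ) → weightMultilinear 𝒱 Q a)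

theorem absorb_revWord_val {p : ℕ} (h : Fin p → Letter 𝒱) (k : Fin p) (J : Finset (Fin p)) :
    (absorb q (h k) (revWord h J)).val = (q J.card : MultilinearMap K (fun _ => V) V)
      (Fin.snoc (α := fun _ => V) (subtuple (fun i => (h i).val) J) (h k).val) := by
  change ofWeightMultilinear 𝒱 q (letterWord 𝒱 (h k :: revWord h J)) = _
  rw [letterWord_cons_revWord, ofWeightMultilinear, liftWord_word]

/-- In the corestriction of `D` only the term that absorbs all letters survives. -/
theorem proj_coderSum (v : Letter 𝒱) (l : List (Letter 𝒱)) :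
    proj (coderSum (letterDeg 𝒱) Q (absorb q) (v :: l) (letterWord 𝒱)) = (absorb q v l).val := by
  rw [map_coderSum, coderSum, coderSum_congr (letterDeg 𝒱) (fun _ _ => rfl)
    (fun x hx _ => proj_letterWord_cons 𝒱 hx v), coderSum_zero, zero_add,
    unshuffleSum_eq_left]
  · simp [proj_letterWord_singleton]
  · intro a b ha
    rw [proj_letterWord_cons 𝒱 ha, smul_zero]

/-- The value of the candidate coderivation is recovered from its corestriction and from its
values on shorter words. -/
theorem coderSum_letterWord_cons (v : Letter 𝒱) (l : List (Letter 𝒱)) :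
    coderSum (letterDeg 𝒱) Q (absorb q) (v :: l) (letterWord 𝒱) =
      incl (absorb q v l).val + coprodSum (letterDeg 𝒱) (v :: l) fun a b =>
        appendLetter (coderSum (letterDeg 𝒱) Q (absorb q) a (letterWord 𝒱))
          (proj (letterWord 𝒱 b)) +
        pairSign Q (wordDeg (letterDeg 𝒱) a) • appendLetter (letterWord 𝒱 a)
          (proj (coderSum (letterDeg 𝒱) Q (absorb q) b (letterWord 𝒱))) := by
  have hD : appendLetter (coderSum (letterDeg 𝒱) Q (absorb q) l (letterWord 𝒱)) v.val =
      coderSum (letterDeg 𝒱) Q (absorb q) l fun x => letterWord 𝒱 (v :: x) := by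
    rw [← LinearMap.flip_apply, map_coderSum]
    exact coderSum_congr (letterDeg 𝒱) (fun _ _ => rfl) fun x hx _ =>
      appendLetter_letterWord 𝒱 hx v
  simp only [coprodSum, proj_coderSum]
  rw [unshuffleSum_add, unshuffleSum_eq_right (f := fun a b =>
      appendLetter (coderSum (letterDeg 𝒱) Q (absorb q) a (letterWord 𝒱))
        (proj (letterWord 𝒱 (v :: b)))),
    proj_letterWord_singleton, hD, add_left_comm, coderSum]
  · congr 1
    -- The term of the inclusion of `V` is the one with `a = []`, which `appendLetter` misses.
    rw [show incl (K := K) (absorb q v l).val = unshuffleSum (letterDeg 𝒱) l fun a b =>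
        if a = [] then letterWord 𝒱 [absorb q v b] else 0 from ?_, ← unshuffleSum_add]
    · refine unshuffleSum_congr _ fun a b _ => ?_
      rcases eq_or_ne a [] with rfl | ha
      · simp
      · rw [if_neg ha, zero_add, appendLetter_letterWord 𝒱 ha]
    · rw [unshuffleSum_eq_left _ fun a b ha => if_neg ha, if_pos rfl, incl_apply]
      rfl
  · intro a b hb
    rw [proj_letterWord_cons 𝒱 hb, map_zero]

variable [DirectSum.Decomposition 𝒱]

/-- The co-Leibniz expression `(D ⊗ id + id ⊗ D) Δ` on a word. -/
theorem gradedMap_coproduct_letterWord (Q : Fin n → ℤ) (D : RedTensor K V →ₗ[K] RedTensor K V)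
    (l : List (Letter 𝒱)) :
    (gradedMap 𝒱 D LinearMap.id 0 + gradedMap 𝒱 LinearMap.id D Q)
        (coproduct 𝒱 (letterWord 𝒱 l)) =
      coprodSum (letterDeg 𝒱) l fun a b => D (letterWord 𝒱 a) ⊗ₜ[K] letterWord 𝒱 b +
        pairSign Q (wordDeg (letterDeg 𝒱) a) • letterWord 𝒱 a ⊗ₜ[K] D (letterWord 𝒱 b) := by
  rw [coproduct_letterWord, map_coprodSum]
  refine coprodSum_congr _ fun a b _ _ => ?_
  simp only [gradedMap, LinearMap.add_apply, TensorProduct.map_tmul, LinearMap.comp_apply,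
    LinearMap.id_apply, degSign_apply 𝒱 _ _ _ (letterWord_mem 𝒱 a), pairSign_zero_left,
    Int.cast_one, one_smul, intCast_smul_redTensor, TensorProduct.smul_tmul']

/-- Every element of `T(V)` is the sum of its component in `V` and of the image of its coproduct
under `u ⊗ w ↦ u ⊗ pr(w)`: only the term `I = {1, …, p - 1}` of `Δ(v₁ ⊗ ⋯ ⊗ v_p)` survives. -/
theorem incl_proj_add_appendProj_coproduct (x : RedTensor K V) :
    incl (proj x) + appendProj (coproduct 𝒱 x) = x := by
  have key : incl ∘ₗ proj + appendProj ∘ₗ coproduct 𝒱 = LinearMap.id := by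
    refine linearMap_ext_letterWord 𝒱 fun l => ?_
    simp only [LinearMap.add_apply, LinearMap.comp_apply, coproduct_letterWord, map_coprodSum,
      appendProj_tmul, LinearMap.id_apply]
    cases l with
    | nil => simp [coprodSum]
    | cons v l =>
      rw [coprodSum, unshuffleSum_eq_right, proj_letterWord_singleton]
      · rcases eq_or_ne l [] with rfl | hl
        · rw [proj_letterWord_singleton, letterWord_nil, map_zero, LinearMap.zero_apply, add_zero,
            incl_apply]
          rfl
        · rw [proj_letterWord_cons 𝒱 hl, map_zero, zero_add, appendLetter_letterWord 𝒱 hl]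
      · intro a b hb
        rw [proj_letterWord_cons 𝒱 hb, map_zero]
  exact LinearMap.congr_fun key x

/-- Approximations of the coderivation with corestrictions `q`: the iterates, starting from `0`, of
`E ↦ ι q + μ (E ⊗ id + id ⊗ E) Δ`, where `ι` is the inclusion of `V` and `μ` is the map
`u ⊗ w ↦ u ⊗ pr(w)`. The `m`-th one is correct on words of length at most `m`. -/
def coderApprox : ℕ → (RedTensor K V →ₗ[K] RedTensor K V)
  | 0 => 0
  | m + 1 => incl ∘ₗ ofWeightMultilinear 𝒱 q + appendProj ∘ₗ
      (gradedMap 𝒱 (coderApprox m) LinearMap.id 0 + gradedMap 𝒱 LinearMap.id (coderApprox m) Q) ∘ₗ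
        coproduct 𝒱

/-- The coderivation with corestrictions `q`. -/
def coderOf : RedTensor K V →ₗ[K] RedTensor K V :=
  liftWord fun p => (coderApprox 𝒱 q (p + 1)).compMultilinearMap (word (p + 1))

/-- If both parts of an unshuffle are non-empty, then both are shorter than the whole word. -/
theorem length_le_of_append_perm_cons {H : Type*} {a b l : List H} {v : H} {m : ℕ}
    (h : (a ++ b).Perm (v :: l)) (hl : l.length ≤ m) :
    (b ≠ [] → a.length ≤ m) ∧ (a ≠ [] → b.length ≤ m) := by
  have := h.length_eq
  simp only [List.length_append, List.length_cons] at this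
  refine ⟨fun hb => ?_, fun ha => ?_⟩
  · have := List.length_pos_iff.2 hb
    omega
  · have := List.length_pos_iff.2 ha
    omega

theorem coderApprox_letterWord (m : ℕ) (l : List (Letter 𝒱)) (hl : l.length ≤ m) :
    coderApprox 𝒱 q m (letterWord 𝒱 l) =
      coderSum (letterDeg 𝒱) Q (absorb q) l (letterWord 𝒱) := by
  induction m generalizing l with
  | zero =>
    obtain rfl := List.length_eq_zero_iff.1 (Nat.le_zero.1 hl)
    rfl
  | succ m ih =>
    cases l with
    | nil => simp [coderSum]
    | cons v l =>
      rw [coderSum_letterWord_cons, coderApprox, LinearMap.add_apply, LinearMap.comp_apply,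
        LinearMap.comp_apply, LinearMap.comp_apply, gradedMap_coproduct_letterWord, map_coprodSum]
      refine congrArg₂ (· + ·) rfl (coprodSum_congr _ fun a b hab hb => ?_)
      obtain ⟨ha', hb'⟩ := length_le_of_append_perm_cons hab (Nat.le_of_succ_le_succ hl)
      rw [map_add, map_zsmul, appendProj_tmul, appendProj_tmul, ih a (ha' hb)]
      -- For `a = []` the word `b` is not shorter, but then the term vanishes.
      rcases eq_or_ne a [] with rfl | ha
      · simp
      · rw [ih b (hb' ha)]

/-- On words in homogeneous letters `coderOf` is given by the recursion `coderSum`. -/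
theorem coderOf_letterWord (l : List (Letter 𝒱)) :
    coderOf 𝒱 q (letterWord 𝒱 l) =
      coderSum (letterDeg 𝒱) Q (absorb q) l (letterWord 𝒱) := by
  obtain ⟨p, h, rfl⟩ := exists_eq_revWord_univ l
  cases p with
  | zero => simp [coderSum, Finset.univ_eq_empty]
  | succ p =>
    rw [← coderApprox_letterWord 𝒱 q (p + 1) _ (by simp [revWord]), letterWord_revWord_univ,
      coderOf, liftWord_word, LinearMap.compMultilinearMap_apply]

theorem coderOf_mem_tensorGrading (α : Fin n → ℤ) (x : RedTensor K V)
    (hx : x ∈ tensorGrading 𝒱 α) : coderOf 𝒱 q x ∈ tensorGrading 𝒱 (Q + α) := by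
  induction hx using Submodule.span_induction with
  | mem x hx =>
    obtain ⟨p, d, v, hv, rfl, rfl⟩ := hx
    let h : Fin (p + 1) → Letter 𝒱 := fun i => ⟨d i, v i, hv i⟩
    have hdeg : wordDeg (letterDeg 𝒱) (revWord h Finset.univ) = ∑ i, d i := wordDeg_revWord _ h _
    have hword : letterWord 𝒱 (revWord h Finset.univ) = word (p + 1) v :=
      letterWord_revWord_univ 𝒱 h
    -- The sum lies in the submodule because it vanishes in the quotient, where every term does.
    rw [← hword, coderOf_letterWord, ← Submodule.Quotient.mk_eq_zero, ← Submodule.mkQ_apply,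
      map_coderSum, ← hdeg, coderSum_congr (letterDeg 𝒱) (fun _ _ => rfl) (g := fun _ => 0),
      coderSum_zero]
    intro x _ hx
    rw [← hx, Submodule.mkQ_apply, Submodule.Quotient.mk_eq_zero]
    exact letterWord_mem 𝒱 x
  | zero => simp
  | add x y _ _ hx hy => rw [map_add]; exact Submodule.add_mem _ hx hy
  | smul c x _ hx => rw [map_smul]; exact Submodule.smul_mem _ c hx

/-- The co-Leibniz rule for `coderOf` is the one for `coderSum`, evaluated at `a, b ↦ a ⊗ b`. -/
theorem coderOf_mem_coDer : coderOf 𝒱 q ∈ CoDer 𝒱 Q := by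
  refine ⟨coderOf_mem_tensorGrading 𝒱 q, linearMap_ext_letterWord 𝒱 fun l => ?_⟩
  rw [LinearMap.comp_apply, LinearMap.comp_apply, gradedMap_coproduct_letterWord,
    coderOf_letterWord, map_coderSum]
  simp only [coproduct_letterWord, coderOf_letterWord]
  rw [coderSum_coprodSum (letterDeg 𝒱) (fun _ _ => rfl)]
  refine coprodSum_congr _ fun a b _ _ => ?_
  have hl := map_coderSum (letterDeg 𝒱) (Q := Q) (q := absorb q)
    ((TensorProduct.mk K (RedTensor K V) (RedTensor K V)).flip (letterWord 𝒱 b)) a (letterWord 𝒱)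
  have hr := map_coderSum (letterDeg 𝒱) (Q := Q) (q := absorb q)
    (TensorProduct.mk K (RedTensor K V) (RedTensor K V) (letterWord 𝒱 a)) b (letterWord 𝒱)
  exact congrArg₂ (· + ·) hl.symm (congrArg _ hr.symm)

theorem proj_comp_coderOf : proj ∘ₗ coderOf 𝒱 q = ofWeightMultilinear 𝒱 q := by
  refine linearMap_ext_letterWord 𝒱 fun l => ?_
  cases l with
  | nil => simp
  | cons v l =>
    rw [LinearMap.comp_apply, coderOf_letterWord, proj_coderSum]
    rfl

theorem corestrictions_coderOf :
    corestrictions 𝒱 Q ⟨coderOf 𝒱 q, coderOf_mem_coDer 𝒱 q⟩ = q := by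
  funext a
  ext v
  change (proj ∘ₗ coderOf 𝒱 q) (word (a + 1) v) = _
  rw [proj_comp_coderOf, ofWeightMultilinear, liftWord_word]

/-- A coderivation is determined by its corestrictions, by induction on the length of words. -/
theorem corestrictions_injective (Q : Fin n → ℤ) :
    Function.Injective (corestrictions 𝒱 Q) := by
  intro D E hDE
  have hproj : proj ∘ₗ (D : RedTensor K V →ₗ[K] RedTensor K V) = proj ∘ₗ E.1 := by
    refine DirectSum.linearMap_ext K fun p => PiTensorProduct.ext ?_
    exact congrArg Subtype.val (congrFun hDE p)
  have key : ∀ m (l : List (Letter 𝒱)), l.length ≤ m →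
      D.1 (letterWord 𝒱 l) = E.1 (letterWord 𝒱 l) := by
    intro m
    induction m with
    | zero =>
      intro l hl
      obtain rfl := List.length_eq_zero_iff.1 (Nat.le_zero.1 hl)
      simp
    | succ m ih =>
      intro l hl
      cases l with
      | nil => simp
      | cons v l =>
        rw [← incl_proj_add_appendProj_coproduct 𝒱 (D.1 (letterWord 𝒱 (v :: l))),
          ← incl_proj_add_appendProj_coproduct 𝒱 (E.1 (letterWord 𝒱 (v :: l))),
          ← LinearMap.comp_apply proj, hproj, ← LinearMap.comp_apply (coproduct 𝒱), D.2.2,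
          ← LinearMap.comp_apply (coproduct 𝒱), E.2.2, LinearMap.comp_apply,
          LinearMap.comp_apply, LinearMap.comp_apply, gradedMap_coproduct_letterWord,
          gradedMap_coproduct_letterWord]
        congr 2
        refine coprodSum_congr _ fun a b hab hb => ?_
        obtain ⟨ha', hb'⟩ := length_le_of_append_perm_cons hab (Nat.le_of_succ_le_succ hl)
        rw [ih a (ha' hb)]
        -- For `a = []` the word `b` is not shorter, but then the term vanishes.
        rcases eq_or_ne a [] with rfl | ha
        · simp
        · rw [ih b (hb' ha)]
  exact Subtype.ext (linearMap_ext_letterWord 𝒱 fun l => key _ l le_rfl)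

theorem coderOf_word {p : ℕ} (d : Fin (p + 1) → Fin n → ℤ) (v : Fin (p + 1) → V)
    (hv : ∀ i, v i ∈ 𝒱 (d i)) :
    coderOf 𝒱 q (word (p + 1) v) =
      ∑ k : Fin (p + 1), ∑ I ∈ (Finset.Iio k).powerset,
        ((koszulSign d I (Finset.Iio k \ I) * pairSign Q (∑ i ∈ I, d i) : ℤ) : K) •
          word _ (Fin.append
            (Fin.snoc (α := fun _ => V) (subtuple v I)
              ((q (Finset.Iio k \ I).card : MultilinearMap K (fun _ => V) V)
                (Fin.snoc (α := fun _ => V) (subtuple v (Finset.Iio k \ I)) (v k))))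
            (subtuple v (Finset.Ioi k))) := by
  let h : Fin (p + 1) → Letter 𝒱 := fun i => ⟨d i, v i, hv i⟩
  have hword : letterWord 𝒱 (revWord h Finset.univ) = word (p + 1) v :=
    letterWord_revWord_univ 𝒱 h
  rw [← hword, coderOf_letterWord, ← sum_eq_coderSum]
  refine Finset.sum_congr rfl fun k _ => ?_
  have hk : Finset.univ.filter (· < k) = Finset.Iio k := by ext; simp
  have hk' : Finset.univ.filter (k < ·) = Finset.Ioi k := by ext; simp
  rw [hk, hk']
  refine Finset.sum_congr rfl fun I _ => ?_
  rw [intCast_smul_redTensor, letterWord_append_cons_revWord, absorb_revWord_val]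
  rfl

end Coder
end

end DualLeibniz

theorem mainTheorem3 {K V : Type*} [Field K] [CharZero K] [AddCommGroup V] [Module K V] {n : ℕ}
    (𝒱 : (Fin n → ℤ) → Submodule K V) [DirectSum.Decomposition 𝒱] (Q : Fin n → ℤ) :
    ∃ ψ : CoDer 𝒱 Q ≃ₗ[K] ((a : ℕ) → weightMultilinear 𝒱 Q a),
      (ψ : CoDer 𝒱 Q →ₗ[K] ((a : ℕ) → weightMultilinear 𝒱 Q a)) = corestrictions 𝒱 Q ∧
      ∀ (q : (a : ℕ) → weightMultilinear 𝒱 Q a) (p : ℕ)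
        (d : Fin (p + 1) → Fin n → ℤ) (v : Fin (p + 1) → V), (∀ i, v i ∈ 𝒱 (d i)) →
        (ψ.symm q : RedTensor K V →ₗ[K] RedTensor K V) (word (p + 1) v) =
          ∑ k : Fin (p + 1), ∑ I ∈ (Finset.Iio k).powerset,
            ((koszulSign d I (Finset.Iio k \ I) * pairSign Q (∑ i ∈ I, d i) : ℤ) : K) •
              word _ (Fin.append
                (Fin.snoc (α := fun _ => V) (subtuple v I)
                  ((q (Finset.Iio k \ I).card : MultilinearMap K (fun _ => V) V)
                    (Fin.snoc (α := fun _ => V) (subtuple v (Finset.Iio k \ I)) (v k))))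
                (subtuple v (Finset.Ioi k))) := by
  let ψ := LinearEquiv.ofBijective (corestrictions 𝒱 Q)
    ⟨corestrictions_injective 𝒱 Q, fun q => ⟨_, corestrictions_coderOf 𝒱 q⟩⟩
  refine ⟨ψ, rfl, fun q p d v hv => ?_⟩
  have hψ : ψ.symm q = ⟨coderOf 𝒱 q, coderOf_mem_coDer 𝒱 q⟩ := by
    rw [LinearEquiv.symm_apply_eq]
    exact (corestrictions_coderOf 𝒱 q).symm
  rw [hψ]
  exact coderOf_word 𝒱 q d v hv
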